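/- Let $\nu:[-\pi,\pi]\to\mathbb{C}$ be a smooth function with $\nu(\pi)-\nu(-\pi)=\delta$, where $\delta$ is a negative integer. For a positive integer $L>|\delta|$ put $\ell=L+\delta$, $q_j=\frac{2\pi}{L}\left(-\frac{L+1}{2}+j\right)$ and $\nu_j=\nu(q_j)$. Then the function $\left[\frac{\nu(q)-\nu(k)-\delta(q-k)/(2\pi)}{4\sin\frac{q-k}{2}}\right]^2$ is integrable on $[-\pi,\pi]^2$ and, as $L\to\infty$ with $\nu$ (hence $\delta$) fixed, $$\prod_{i=1}^{\ell}\prod_{j=1}^{i-1}\frac{\sin\frac{\pi}{L}(i-j-\nu_i+\nu_j)}{\sin\frac{\pi(i-j)}{L}}\;\sim\;\frac{L^{\delta^2/2}\,(2\pi)^{-(\delta^2+\delta)/2}\,e^{\delta/2}}{G(1-\delta)}\,\exp\left(-\int_{-\pi}^{\pi}dq\int_{-\pi}^{\pi}dk\left[\frac{\nu(q)-\nu(k)-\delta(q-k)/(2\pi)}{4\sin\frac{q-k}{2}}\right]^2\right),$$ meaning that the ratio of the two sides tends to $1$. Here $G$ is the Barnes $G$-function, given at positive integers by $G(1)=1$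 and $G(n+1)=\Gamma(n)\,G(n)$. -/

import Mathlib

open scoped ContDiff

noncomputable section

/-- The lattice momentum `q_j = (2π/L) (-(L+1)/2 + j)`. -/
def latticeMomentum (L : ℕ) (j : ℤ) : ℝ :=
  2 * Real.pi / L * (-((L : ℝ) + 1) / 2 + j)

/-- The value `ν_j = ν(q_j)` of the phase shift at the `j`-th lattice momentum. -/
def phaseAt (ν : ℝ → ℂ) (L : ℕ) (j : ℤ) : ℂ :=
  ν (latticeMomentum L j)

/-- The double product over `1 ≤ j < i ≤ ℓ` of
`sin(π(i-j-ν_i+ν_j)/L) / sin(π(i-j)/L)`. -/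
def sineDoubleProduct (ν : ℝ → ℂ) (L : ℕ) (ℓ : ℤ) : ℂ :=
  ∏ i ∈ Finset.Icc 1 ℓ, ∏ j ∈ Finset.Icc 1 (i - 1),
    Complex.sin ((Real.pi : ℂ) / L * ((i : ℂ) - j - phaseAt ν L i + phaseAt ν L j)) /
      Complex.sin ((Real.pi : ℂ) * ((i : ℂ) - j) / L)

/-- The squared kernel
`[(ν(q) - ν(k) - δ (q-k)/(2π)) / (4 sin((q-k)/2))]²`. -/
def phaseKernel (ν : ℝ → ℂ) (δ : ℤ) (q k : ℝ) : ℂ :=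
  ((ν q - ν k - (δ : ℂ) * ((q : ℂ) - k) / (2 * Real.pi)) /
    (4 * Complex.sin (((q : ℂ) - k) / 2))) ^ 2

/-- The Barnes `G`-function at the natural numbers: `G(0) = 0`, `G(1) = 1` and
`G(n+1) = Γ(n) G(n)` for `n ≥ 1`. -/
def barnesG : ℕ → ℝ
  | 0 => 0
  | 1 => 1
  | n + 2 => Real.Gamma (n + 1) * barnesG (n + 1)

end

/-!
The double product is evaluated by comparing it with the same product over equidistributed points.
Write `δ = -m` and `L = n + m`, so that there are `n` sites. With the corrected phases
`g i = ν_i + m i / n` (`sitePhase`) one has exactly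
`π (i - j - ν_i + ν_j) / L = π (i - j) / n - (π / L) (g i - g j)`,
so the product splits (`sineDoubleProduct_eq`) into an explicit factor
`∏ sin (π (i - j) / n) / sin (π (i - j) / L)` and a perturbed product
`∏ sin (θ - η) / sin θ` with `θ = π (i - j) / n` and `η = (π / L) (g i - g j)`.

The explicit factor reduces to the products `∏_{d ≤ r} 2 sin (π d / N)`. Their full product equals
`N`, whence by reflection the product over all pairs of `N` equidistributed points is `N ^ (N / 2)`.
In the denominator only `n = L - m` of the `L` rows occur; the `m` missing rows are, by reflection,
`L / ∏_{d ≤ r} 2 sin (π d / L)` with `r < m`, asymptotically `L ^ (r + 1) / (r! (2 π) ^ r)`. This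
produces the power of `L`, the power of `2 π` and the Barnes function `∏_{r < m} r!`, while
`(n / L) ^ (n / 2)` produces `e ^ (-m / 2)` (`tendsto_prod_sinePartialProduct_div`).

For the perturbed product the winding condition makes `g` Lipschitz for the circular distance of
sites, so that `η / sin θ = O(1 / n)` uniformly in all pairs (`exists_norm_relativeShift_le`), and
each factor is `exp (-η cot θ - η² / (2 sin² θ) + O(n⁻³))` (`exists_sin_sub_eq_mul_exp`). The
first-order terms cancel exactly because the cotangent is odd and sums to zero over the
equidistributed angles (`sum_relativeShift_mul_cos`); the second-order terms form a bounded double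
Riemann sum, which converges to the integral by dominated convergence
(`tendsto_sum_relativeShift_sq`); the `O(n²)` remainders are negligible. The same Lipschitz bound
makes the kernel bounded, hence integrable.
-/

open Filter Topology Finset MeasureTheory

/-! ### Products of sines over equidistributed angles -/

/-- The product `∏_{d=1}^{r} 2 sin (π d / n)`, in terms of which every Vandermonde-type product of
sines at equally spaced points can be written. -/
noncomputable def sinePartialProduct (n r : ℕ) : ℝ :=
  ∏ d ∈ range r, 2 * Real.sin (Real.pi * (d + 1) / n)

lemma sinePartialProduct_pos {n r : ℕ} (h : r < n) : 0 < sinePartialProduct n r := by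
  refine prod_pos fun d hd => ?_
  have hd : d + 1 < n := by have := mem_range.1 hd; omega
  have hn : (0 : ℝ) < n := by exact_mod_cast (by omega : 0 < n)
  have hd' : (d : ℝ) + 1 < n := by exact_mod_cast hd
  refine mul_pos two_pos (Real.sin_pos_of_pos_of_lt_pi (by positivity) ?_)
  rw [div_lt_iff₀ hn]
  exact mul_lt_mul_of_pos_left hd' Real.pi_pos

/-- The classical evaluation `∏_{d=1}^{n} 2 sin (π d / (n + 1)) = n + 1`, obtained by taking
norms in `∏ (1 - ζ ^ d) = n + 1` for a primitive root of unity `ζ` of order `n + 1`. -/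
lemma sinePartialProduct_succ_self (n : ℕ) : sinePartialProduct (n + 1) n = n + 1 := by
  have h := (Complex.isPrimitiveRoot_exp (n + 1) n.succ_ne_zero).prod_one_sub_pow_eq_order
  have h2 := congrArg norm h
  rw [norm_prod] at h2
  have h3 : ‖((n : ℂ) + 1)‖ = n + 1 := by
    have : ((n : ℂ) + 1) = ((n + 1 : ℕ) : ℂ) := by push_cast; rfl
    rw [this, Complex.norm_natCast]; push_cast; rfl
  rw [h3] at h2
  rw [← h2, sinePartialProduct]
  refine prod_congr rfl fun d hd => ?_
  have hd' : (d : ℝ) + 1 < n + 1 := by exact_mod_cast Nat.succ_lt_succ (mem_range.1 hd)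
  rw [← Complex.exp_nat_mul, norm_sub_rev]
  have : ((d + 1 : ℕ) : ℂ) * (2 * Real.pi * Complex.I / ((n + 1 : ℕ) : ℂ)) =
      Complex.I * ((2 * (Real.pi * (d + 1) / (n + 1)) : ℝ) : ℂ) := by
    push_cast; ring
  rw [this, Complex.norm_exp_I_mul_ofReal_sub_one, Real.norm_of_nonneg]
  · push_cast; congr 2; ring
  · refine mul_nonneg two_pos.le (Real.sin_nonneg_of_nonneg_of_le_pi (by positivity) ?_)
    rw [mul_div_cancel_left₀ _ two_ne_zero, div_le_iff₀ (by positivity)]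
    exact mul_le_mul_of_nonneg_left hd'.le Real.pi_pos.le

lemma sinePartialProduct_mul_of_add {n r s : ℕ} (h : r + s + 1 = n) :
    sinePartialProduct n r * sinePartialProduct n s = n := by
  subst h
  have h1 := sinePartialProduct_succ_self (r + s)
  rw [sinePartialProduct, prod_range_add] at h1
  push_cast at h1 ⊢
  rw [← h1, sinePartialProduct]
  push_cast
  congr 1
  rw [sinePartialProduct, ← prod_range_reflect]
  refine prod_congr rfl fun d hd => ?_
  have hd' : d + 1 ≤ s := mem_range.1 hd
  have hn : (r : ℝ) + s + 1 ≠ 0 := by positivity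
  rw [← Real.sin_pi_sub]
  congr 2
  rw [Nat.sub_sub, add_comm 1 d, Nat.cast_sub hd']
  push_cast
  field_simp
  ring

lemma prod_sinePartialProduct_sq (n : ℕ) :
    (∏ i ∈ range n, sinePartialProduct n i) ^ 2 = (n : ℝ) ^ n := by
  rw [sq]
  nth_rw 2 [← prod_range_reflect]
  rw [← prod_mul_distrib, prod_congr rfl (g := fun _ => (n : ℝ)), prod_const, card_range]
  intro i hi
  have := mem_range.1 hi
  exact sinePartialProduct_mul_of_add (by omega)

lemma tendsto_mul_sin_div (c : ℝ) :
    Tendsto (fun n : ℕ => (n : ℝ) * Real.sin (c / n)) atTop (𝓝 c) := by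
  have h : Tendsto (fun n : ℕ => c * Real.sinc (c / n)) atTop (𝓝 (c * Real.sinc 0)) :=
    ((Real.continuous_sinc.tendsto 0).comp (tendsto_const_div_atTop_nhds_zero_nat c)).const_mul c
  rw [Real.sinc_zero, mul_one] at h
  refine h.congr' ?_
  filter_upwards [eventually_gt_atTop 0] with n hn
  have hn' : (n : ℝ) ≠ 0 := by exact_mod_cast hn.ne'
  rcases eq_or_ne c 0 with rfl | hc
  · simp
  · rw [Real.sinc_of_ne_zero (div_ne_zero hc hn')]
    field_simp

lemma tendsto_sinePartialProduct_mul_pow (r : ℕ) :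
    Tendsto (fun n : ℕ => sinePartialProduct n r * (n : ℝ) ^ r) atTop
      (𝓝 (r.factorial * (2 * Real.pi) ^ r)) := by
  induction r with
  | zero => simp [sinePartialProduct]
  | succ r ih =>
    have h := ih.mul ((tendsto_mul_sin_div (Real.pi * (r + 1))).const_mul 2)
    convert h using 2
    · rw [sinePartialProduct, sinePartialProduct, prod_range_succ]; ring
    · rw [Nat.factorial_succ]; push_cast; ring

/-! ### The quotient of two equidistributed sine products -/

lemma barnesG_succ_eq_prod_factorial (m : ℕ) :
    barnesG (m + 1) = ∏ r ∈ range m, (r.factorial : ℝ) := by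
  induction m with
  | zero => simp [barnesG]
  | succ m ih => rw [barnesG, ih, Real.Gamma_nat_eq_factorial, prod_range_succ, mul_comm]

/-- The square of the quotient of the sine products over `n` points spaced as `n`-th and as
`(n + m)`-th roots of unity. The `n + m` complementary factors of the denominator are removed by
the reflection `d ↦ n + m - d`. -/
lemma prod_sinePartialProduct_div_sq (n m : ℕ) (hn : 0 < n) :
    (∏ i ∈ range n, sinePartialProduct n i / sinePartialProduct (n + m) i) ^ 2 =
      ((n + m : ℕ) : ℝ) ^ (m ^ 2) * (((1 + m / n : ℝ) ^ n)⁻¹ *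
        (∏ r ∈ range m, (sinePartialProduct (n + m) r * ((n + m : ℕ) : ℝ) ^ r)⁻¹) ^ 2) := by
  set L : ℝ := ((n + m : ℕ) : ℝ) with hL
  have hn' : (0 : ℝ) < n := by exact_mod_cast hn
  have hLpos : 0 < L := by rw [hL]; push_cast; positivity
  have h1 : (∏ i ∈ range n, sinePartialProduct (n + m) i) =
      (∏ i ∈ range (n + m), sinePartialProduct (n + m) i) *
        ∏ r ∈ range m, sinePartialProduct (n + m) r / L := by
    rw [prod_range_add, mul_assoc,
      ← prod_range_reflect (fun x => sinePartialProduct (n + m) (n + x)) m, ← prod_mul_distrib]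
    rw [prod_eq_one (s := range m), mul_one]
    intro r hr
    have := mem_range.1 hr
    rw [mul_div_assoc', sinePartialProduct_mul_of_add (by omega), ← hL, div_self hLpos.ne']
  have h2 : ∀ k : ℕ, (∏ r ∈ range k, L ^ (r + 1)) ^ 2 = L ^ (k ^ 2) * L ^ k := by
    intro k
    rw [prod_pow_eq_pow_sum, ← pow_mul, ← pow_add, sum_add_distrib, sum_const, card_range,
      add_mul, sum_range_id_mul_two]
    congr 1
    cases k <;> simp; ring
  have h3 : (∏ r ∈ range m, sinePartialProduct (n + m) r / L) =
      (∏ r ∈ range m, L ^ (r + 1))⁻¹ * (∏ r ∈ range m, (sinePartialProduct (n + m) r * L ^ r)) := by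
    rw [← prod_inv_distrib, ← prod_mul_distrib]
    refine prod_congr rfl fun r _ => ?_
    field_simp
    ring
  have h4 : (1 + m / n : ℝ) = L / n := by rw [hL]; push_cast; field_simp
  rw [prod_div_distrib, h1, h3, div_pow, mul_pow, mul_pow, prod_sinePartialProduct_sq,
    prod_sinePartialProduct_sq, ← hL, inv_pow, h2 m, h4, prod_inv_distrib, div_pow, pow_add]
  have h5 : (∏ r ∈ range m, (sinePartialProduct (n + m) r * L ^ r)) ≠ 0 :=
    (prod_pos fun r hr => mul_pos (sinePartialProduct_pos (by
      have := mem_range.1 hr; omega)) (by positivity)).ne'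
  field_simp

lemma tendsto_prod_sinePartialProduct_div (m : ℕ) :
    Tendsto (fun n : ℕ => (∏ i ∈ range n, sinePartialProduct n i / sinePartialProduct (n + m) i) /
        ((n + m : ℕ) : ℝ) ^ ((m : ℝ) ^ 2 / 2)) atTop
      (𝓝 (Real.exp (-m / 2) * (2 * Real.pi) ^ (-((m : ℝ) ^ 2 - m) / 2) / barnesG (m + 1))) := by
  have h1 : Tendsto (fun n : ℕ => Real.sqrt (((1 + m / n : ℝ) ^ n)⁻¹) *
      (∏ r ∈ range m, (sinePartialProduct (n + m) r * ((n + m : ℕ) : ℝ) ^ r)⁻¹)) atTop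
      (𝓝 (Real.sqrt ((Real.exp m)⁻¹) *
        ∏ r ∈ range m, ((r.factorial : ℝ) * (2 * Real.pi) ^ r)⁻¹)) := by
    refine Tendsto.mul ?_ (tendsto_finsetProd _ fun r _ => ?_)
    · exact (Real.continuous_sqrt.tendsto _).comp
        ((Real.tendsto_one_add_div_pow_exp m).inv₀ (Real.exp_pos _).ne')
    · exact (((tendsto_sinePartialProduct_mul_pow r).comp (tendsto_add_atTop_nat m))).inv₀
        (by positivity)
  have h2 : Real.sqrt ((Real.exp m)⁻¹) * ∏ r ∈ range m, ((r.factorial : ℝ) * (2 * Real.pi) ^ r)⁻¹ =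
      Real.exp (-m / 2) * (2 * Real.pi) ^ (-((m : ℝ) ^ 2 - m) / 2) / barnesG (m + 1) := by
    rw [barnesG_succ_eq_prod_factorial, prod_inv_distrib, prod_mul_distrib, prod_pow_eq_pow_sum,
      mul_inv, ← Real.exp_neg, Real.sqrt_eq_rpow, ← Real.exp_mul, neg_div 2 ((m : ℝ) ^ 2 - m),
      Real.rpow_neg (by positivity),
      ← Real.rpow_natCast (2 * Real.pi)]
    have h : ((∑ i ∈ range m, i : ℕ) : ℝ) = ((m : ℝ) ^ 2 - m) / 2 := by
      have h := sum_range_id_mul_two m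
      have h' : ((∑ i ∈ range m, i : ℕ) : ℝ) * 2 = m * ((m - 1 : ℕ) : ℝ) := by exact_mod_cast h
      cases m with
      | zero => simp
      | succ m => rw [Nat.add_sub_cancel] at h'; push_cast at h' ⊢; linarith
    rw [h, show -(m : ℝ) * (1 / 2) = -(m : ℝ) / 2 by ring]
    ring_nf
  rw [← h2]
  refine h1.congr' ?_
  filter_upwards [eventually_gt_atTop 0] with n hn
  have hL : (0 : ℝ) < ((n + m : ℕ) : ℝ) := by exact_mod_cast (by omega : 0 < n + m)
  have hpos : ∀ r < m, 0 < sinePartialProduct (n + m) r := fun r hr =>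
    sinePartialProduct_pos (by omega)
  rw [eq_div_iff (by positivity), ← sq_eq_sq₀, prod_sinePartialProduct_div_sq n m hn]
  · have hsq : (((n + m : ℕ) : ℝ) ^ ((m : ℝ) ^ 2 / 2)) ^ 2 = ((n + m : ℕ) : ℝ) ^ (m ^ 2) := by
      rw [← Real.rpow_natCast _ 2, ← Real.rpow_mul hL.le, ← Real.rpow_natCast _ (m ^ 2)]
      push_cast
      rw [div_mul_cancel₀ _ two_ne_zero]
    rw [mul_pow, mul_pow, Real.sq_sqrt (by positivity), hsq]
    ring
  · refine mul_nonneg (mul_nonneg (Real.sqrt_nonneg _) (prod_nonneg fun r hr => ?_)) (by positivity)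
    have := hpos r (mem_range.1 hr)
    positivity
  · refine prod_nonneg fun i hi => ?_
    have hi := mem_range.1 hi
    exact div_nonneg (sinePartialProduct_pos hi).le (sinePartialProduct_pos (by omega)).le

/-! ### Expansion of a perturbed sine -/

/-- Second-order expansion of a perturbed sine. With `η = t sin θ` the first-order term is
`η cot θ` and the second-order term is `η² / (2 sin² θ)`; the remainder is controlled by the
size of `t = η / sin θ` alone, however close `θ` is to a zero of the sine. -/
lemma exists_sin_sub_eq_mul_exp {θ : ℝ} {t : ℂ} {a : ℝ} (hθ : Real.sin θ ≠ 0) (hta : ‖t‖ ≤ a)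
    (ha : a ≤ 1 / 4) :
    ∃ R : ℂ, ‖R‖ ≤ 8 * a ^ 3 ∧ Complex.sin (θ - t * Real.sin θ) =
      Real.sin θ * Complex.exp (-(t * Real.cos θ) - t ^ 2 / 2 + R) := by
  set s : ℂ := (Real.sin θ : ℂ) with hs
  set c : ℂ := (Real.cos θ : ℂ) with hc
  have ha0 : 0 ≤ a := (norm_nonneg t).trans hta
  have hs0 : s ≠ 0 := by rw [hs]; exact_mod_cast hθ
  have hs1 : ‖s‖ ≤ 1 := by
    rw [hs, Complex.norm_real]; exact Real.abs_sin_le_one θ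
  have hc1 : ‖c‖ ≤ 1 := by
    rw [hc, Complex.norm_real]; exact Real.abs_cos_le_one θ
  have hsc : s ^ 2 + c ^ 2 = 1 := by
    rw [hs, hc]; exact_mod_cast Real.sin_sq_add_cos_sq θ
  have hη : ‖t * s‖ ≤ a := by
    rw [norm_mul]; exact (mul_le_of_le_one_right (norm_nonneg _) hs1).trans hta
  have hη1 : ‖t * s‖ ≤ 1 := by linarith
  obtain ⟨ρ, hρ⟩ : ∃ ρ, ρ = Complex.cos (t * s) - (1 - (t * s) ^ 2 / 2) := ⟨_, rfl⟩
  obtain ⟨σ, hσ⟩ : ∃ σ, σ * s = Complex.sin (t * s) - t * s :=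
    ⟨(Complex.sin (t * s) - t * s) / s, div_mul_cancel₀ _ hs0⟩
  have hρn : ‖ρ‖ ≤ a ^ 3 / 16 := by
    rw [hρ]
    calc _ ≤ ‖t * s‖ ^ 4 * (5 / 96) := Complex.cos_bound hη1
      _ ≤ a ^ 4 * (5 / 96) := by gcongr
      _ = a ^ 3 * (a * (5 / 96)) := by ring
      _ ≤ a ^ 3 * (1 / 16) := by gcongr; linarith
      _ = _ := by ring
  have hσn : ‖σ‖ ≤ a ^ 3 / 3 := by
    have h1 : ‖σ * s‖ ≤ ‖t * s‖ ^ 3 / 3 := by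
      rw [hσ]
      calc ‖Complex.sin (t * s) - t * s‖
          = ‖(Complex.sin (t * s) - (t * s - (t * s) ^ 3 / 6)) - (t * s) ^ 3 / 6‖ := by
            congr 1; ring
        _ ≤ ‖t * s‖ ^ 5 / 100 + ‖t * s‖ ^ 3 / 6 := by
            refine (norm_sub_le _ _).trans (add_le_add (Complex.sin_bound hη1) ?_)
            rw [norm_div, norm_pow]; simp
        _ ≤ ‖t * s‖ ^ 3 * 1 / 100 + ‖t * s‖ ^ 3 / 6 := by
            have : ‖t * s‖ ^ 5 ≤ ‖t * s‖ ^ 3 * 1 := by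
              rw [mul_one]; exact pow_le_pow_of_le_one (norm_nonneg _) hη1 (by norm_num)
            gcongr
        _ ≤ _ := by have := pow_nonneg (norm_nonneg (t * s)) 3; linarith
    have hsp : 0 < ‖s‖ := norm_pos_iff.2 hs0
    rw [norm_mul, norm_mul, mul_pow] at h1
    have h2 : ‖s‖ ^ 3 ≤ ‖s‖ := by
      calc ‖s‖ ^ 3 ≤ ‖s‖ ^ 1 := pow_le_pow_of_le_one (norm_nonneg _) hs1 (by norm_num)
        _ = _ := pow_one _
    have h3 : ‖σ‖ * ‖s‖ ≤ a ^ 3 / 3 * ‖s‖ := by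
      calc _ ≤ ‖t‖ ^ 3 * ‖s‖ ^ 3 / 3 := h1
        _ ≤ a ^ 3 * ‖s‖ / 3 := by gcongr
        _ = _ := by ring
    exact le_of_mul_le_mul_right h3 hsp
  -- `sin (θ - t s) = s (1 + u)` with `u = -t c - (t s)² / 2 + O(a³)`
  set w : ℂ := ρ - c * σ with hw
  have hwn : ‖w‖ ≤ a ^ 3 / 2 := by
    calc _ ≤ ‖ρ‖ + ‖c * σ‖ := norm_sub_le _ _
      _ ≤ a ^ 3 / 16 + 1 * (a ^ 3 / 3) := by rw [norm_mul]; gcongr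
      _ ≤ _ := by have := pow_nonneg ha0 3; linarith
  set v : ℂ := -((t * s) ^ 2 / 2) + w with hv
  have hvn : ‖v‖ ≤ a ^ 2 := by
    calc _ ≤ ‖(t * s) ^ 2 / 2‖ + ‖w‖ := (norm_add_le _ _).trans (by rw [norm_neg])
      _ ≤ a ^ 2 / 2 + a ^ 3 / 2 := by
          gcongr; rw [norm_div, norm_pow]; simp only [Complex.norm_ofNat]; gcongr
      _ = a ^ 2 / 2 + a ^ 2 * a / 2 := by ring
      _ ≤ a ^ 2 / 2 + a ^ 2 * 1 / 2 := by gcongr; linarith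
      _ = _ := by ring
  set u : ℂ := -(t * c) + v with hu
  have htc : ‖t * c‖ ≤ a := by
    rw [norm_mul]; exact (mul_le_of_le_one_right (norm_nonneg _) hc1).trans hta
  have ha2 : a ^ 2 ≤ a / 4 := by nlinarith
  have hun : ‖u‖ ≤ 5 / 4 * a := by
    calc _ ≤ ‖t * c‖ + ‖v‖ := (norm_add_le _ _).trans (by rw [norm_neg])
      _ ≤ _ := by linarith
  have hu1 : ‖u‖ < 1 := by linarith
  have hlog := Complex.norm_log_sub_logTaylor_le 2 hu1
  have hT : Complex.logTaylor (2 + 1) u = u - u ^ 2 / 2 := by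
    simp [Complex.logTaylor_succ, Complex.logTaylor_zero]; ring
  rw [hT] at hlog
  have hlog' : ‖Complex.log (1 + u) - (u - u ^ 2 / 2)‖ ≤ 2 * a ^ 3 := by
    refine hlog.trans ?_
    have hinv : (1 - ‖u‖)⁻¹ ≤ 2 := by
      rw [inv_le_comm₀ (by linarith) two_pos]; linarith
    calc _ ≤ (5 / 4 * a) ^ (2 + 1) * 2 / ((2 : ℕ) + 1) := by gcongr
      _ ≤ _ := by push_cast; have := pow_nonneg ha0 3; nlinarith
  have hne : 1 + u ≠ 0 := by
    intro h0
    have : u = -1 := by linear_combination h0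
    rw [this] at hu1; simp at hu1
  refine ⟨(Complex.log (1 + u) - (u - u ^ 2 / 2)) + (w + (t * c) * v - v ^ 2 / 2), ?_, ?_⟩
  · calc _ ≤ 2 * a ^ 3 + (a ^ 3 / 2 + a * a ^ 2 + (a ^ 2) ^ 2 / 2) := by
          refine (norm_add_le _ _).trans (add_le_add hlog' ((norm_sub_le _ _).trans (add_le_add
            ((norm_add_le _ _).trans (add_le_add hwn ?_)) ?_)))
          · rw [norm_mul]; gcongr
          · rw [norm_div, norm_pow]; simp only [Complex.norm_ofNat]; gcongr
      _ ≤ _ := by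
          have h3 := pow_nonneg ha0 3
          have : (a ^ 2) ^ 2 ≤ a ^ 3 := by nlinarith
          nlinarith
  · have hexp : -(t * c) - t ^ 2 / 2 + ((Complex.log (1 + u) - (u - u ^ 2 / 2)) +
        (w + (t * c) * v - v ^ 2 / 2)) = Complex.log (1 + u) := by
      rw [hu, hv]; linear_combination (t ^ 2 / 2) * hsc
    rw [hexp, Complex.exp_log hne, Complex.sin_sub, ← Complex.ofReal_sin, ← Complex.ofReal_cos,
      ← hs, ← hc]
    linear_combination s * hρ.symm + c * hσ + s * hu + s * hv + s * hw

/-! ### Riemann sums over the unit square -/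

lemma integral_floor_mul_eq_sum (n : ℕ) (hn : 0 < n) (f : ℕ → ℂ) :
    IntervalIntegrable (fun x : ℝ => f ⌊n * x⌋₊) volume 0 1 ∧
      ∫ x in (0 : ℝ)..1, f ⌊n * x⌋₊ = (∑ i ∈ range n, f i) / n := by
  have hn' : (0 : ℝ) < n := by exact_mod_cast hn
  have hle : ∀ k : ℕ, (k : ℝ) / n ≤ ((k + 1 : ℕ) : ℝ) / n := fun k => by
    gcongr; simp
  have hEq : ∀ k : ℕ, Set.EqOn (fun _ : ℝ => f k) (fun x : ℝ => f ⌊n * x⌋₊)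
      (Set.Ioo ((k : ℝ) / n) (((k + 1 : ℕ) : ℝ) / n)) := by
    intro k x hx
    have h1 : (k : ℝ) < n * x := by rw [mul_comm]; exact (div_lt_iff₀ hn').1 hx.1
    have h2 : n * x < (k : ℝ) + 1 := by
      rw [mul_comm]; exact_mod_cast (lt_div_iff₀ hn').1 hx.2
    have hk : (0 : ℝ) ≤ k := Nat.cast_nonneg k
    have h3 : ⌊n * x⌋₊ = k := (Nat.floor_eq_iff (by linarith)).2 ⟨h1.le, h2⟩
    simp [h3]
  have hint : ∀ k : ℕ, IntervalIntegrable (fun x : ℝ => f ⌊n * x⌋₊) volume ((k : ℝ) / n)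
      (((k + 1 : ℕ) : ℝ) / n) := by
    intro k
    refine (intervalIntegrable_const (c := f k)).congr_uIoo ?_
    rw [Set.uIoo_of_le (hle k)]
    exact hEq k
  have h01 : ((0 : ℕ) : ℝ) / n = 0 := by simp
  have h11 : (n : ℝ) / n = 1 := div_self hn'.ne'
  constructor
  · have := IntervalIntegrable.trans_iterate (a := fun k : ℕ => (k : ℝ) / n) (n := n)
      fun k _ => hint k
    rwa [h01, h11] at this
  · have := intervalIntegral.sum_integral_adjacent_intervals (a := fun k : ℕ => (k : ℝ) / n) (n := n)
      (μ := volume) fun k _ => hint k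
    rw [h01, h11] at this
    rw [← this, sum_div]
    refine sum_congr rfl fun k _ => ?_
    rw [← intervalIntegral.integral_congr_Ioo_of_le (hle k) (hEq k),
      intervalIntegral.integral_const]
    rw [← sub_div]; push_cast
    rw [add_sub_cancel_left, Complex.real_smul]; push_cast; ring

/-- Double Riemann sums of a bounded array converge to the iterated integral of its pointwise
limit off the diagonal. The array is viewed as a step function on the unit square, so that
dominated convergence applies in each variable. -/
lemma tendsto_double_sum_div_sq {F : ℕ → ℕ → ℕ → ℂ} {K : ℝ → ℝ → ℂ} {B : ℝ}
    (hB : ∀ᶠ n in atTop, ∀ i < n, ∀ j < n, ‖F n i j‖ ≤ B)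
    (hK : ∀ x ∈ Set.Ioo (0 : ℝ) 1, ∀ y ∈ Set.Ioo (0 : ℝ) 1, x ≠ y →
      Tendsto (fun n : ℕ => F n ⌊n * x⌋₊ ⌊n * y⌋₊) atTop (𝓝 (K x y))) :
    Tendsto (fun n : ℕ => (∑ i ∈ range n, ∑ j ∈ range n, F n i j) / (n : ℂ) ^ 2) atTop
      (𝓝 (∫ x in (0 : ℝ)..1, ∫ y in (0 : ℝ)..1, K x y)) := by
  have hfl : ∀ n : ℕ, 0 < n → ∀ x ∈ Set.Ioo (0 : ℝ) 1, ⌊n * x⌋₊ < n := by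
    intro n hn x hx
    have hn' : (0 : ℝ) < n := by exact_mod_cast hn
    rw [Nat.floor_lt (by have := hx.1; positivity)]
    nlinarith [hx.2]
  have hae : ∀ᵐ x : ℝ ∂volume, x ∈ Set.uIoc (0 : ℝ) 1 → x ∈ Set.Ioo (0 : ℝ) 1 := by
    filter_upwards [compl_mem_ae_iff.2 (measure_singleton (1 : ℝ))] with x hx hx1
    rw [Set.uIoc_of_le zero_le_one] at hx1
    exact ⟨hx1.1, lt_of_le_of_ne hx1.2 hx⟩
  have hinner : ∀ x ∈ Set.Ioo (0 : ℝ) 1, Tendsto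
      (fun n : ℕ => (∑ j ∈ range n, F n ⌊n * x⌋₊ j) / (n : ℂ)) atTop
      (𝓝 (∫ y in (0 : ℝ)..1, K x y)) := by
    intro x hx
    have : Tendsto (fun n : ℕ => ∫ y in (0 : ℝ)..1, F n ⌊n * x⌋₊ ⌊n * y⌋₊) atTop
        (𝓝 (∫ y in (0 : ℝ)..1, K x y)) := by
      refine intervalIntegral.tendsto_integral_filter_of_dominated_convergence (fun _ => B) ?_ ?_
        intervalIntegrable_const ?_
      · filter_upwards [eventually_gt_atTop 0] with n hn
        have h := (integral_floor_mul_eq_sum n hn (F n ⌊n * x⌋₊)).1.aestronglyMeasurable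
        rwa [← Set.uIoc_of_le zero_le_one] at h
      · filter_upwards [eventually_gt_atTop 0, hB] with n hn hBn
        filter_upwards [hae] with y hy hy1
        exact hBn _ (hfl n hn x hx) _ (hfl n hn y (hy hy1))
      · filter_upwards [hae, compl_mem_ae_iff.2 (measure_singleton x)] with y hy hyx hy1
        exact hK x hx y (hy hy1) fun h => hyx h.symm
    refine this.congr' ?_
    filter_upwards [eventually_gt_atTop 0] with n hn
    exact (integral_floor_mul_eq_sum n hn _).2
  have : Tendsto (fun n : ℕ => ∫ x in (0 : ℝ)..1, (∑ j ∈ range n, F n ⌊n * x⌋₊ j) / (n : ℂ)) atTop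
      (𝓝 (∫ x in (0 : ℝ)..1, ∫ y in (0 : ℝ)..1, K x y)) := by
    refine intervalIntegral.tendsto_integral_filter_of_dominated_convergence (fun _ => B) ?_ ?_
      intervalIntegrable_const ?_
    · filter_upwards [eventually_gt_atTop 0] with n hn
      have h := (integral_floor_mul_eq_sum n hn
        fun i => (∑ j ∈ range n, F n i j) / (n : ℂ)).1.aestronglyMeasurable
      rwa [← Set.uIoc_of_le zero_le_one] at h
    · filter_upwards [eventually_gt_atTop 0, hB] with n hn hBn
      filter_upwards [hae] with x hx hx1
      have hn' : (0 : ℝ) < n := by exact_mod_cast hn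
      rw [norm_div, Complex.norm_natCast, div_le_iff₀ hn']
      refine (norm_sum_le_of_le _ fun j hj =>
        hBn _ (hfl n hn x (hx hx1)) j (mem_range.1 hj)).trans ?_
      rw [sum_const, card_range, nsmul_eq_mul, mul_comm]
    · filter_upwards [hae] with x hx hx1
      exact hinner x (hx hx1)
  refine this.congr' ?_
  filter_upwards [eventually_gt_atTop 0] with n hn
  rw [(integral_floor_mul_eq_sum n hn fun i => (∑ j ∈ range n, F n i j) / (n : ℂ)).2, ← sum_div,
    div_div, sq]

/-! ### Symmetric and periodic sums -/

lemma sum_range_sum_range_eq_of_symm {f : ℕ → ℕ → ℂ} (hf : ∀ i j, f i j = f j i)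
    (hd : ∀ i, f i i = 0) (n : ℕ) :
    2 * ∑ i ∈ range n, ∑ j ∈ range i, f i j = ∑ i ∈ range n, ∑ j ∈ range n, f i j := by
  induction n with
  | zero => simp
  | succ n ih =>
    simp only [sum_range_succ, sum_add_distrib, mul_add, ih, hd, add_zero]
    rw [sum_congr rfl fun i _ => hf i n]
    ring

/-- A function on the integers that is odd and `n`-periodic sums to zero over any period. -/
lemma sum_range_sub_eq_zero_of_odd_periodic {c : ℤ → ℂ} {n : ℕ} (hodd : ∀ d, c (-d) = -c d)
    (hper : ∀ d, c (d + n) = c d) (i : ℕ) : ∑ j ∈ range n, c ((i : ℤ) - j) = 0 := by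
  have hshift : ∀ a : ℤ, ∑ j ∈ range n, c (a + 1 - j) = ∑ j ∈ range n, c (a - j) := by
    intro a
    have h := sum_range_succ' (fun j : ℕ => c (a + 1 - j)) n
    rw [sum_range_succ] at h
    have h1 : c (a + 1 - (0 : ℕ)) = c (a + 1 - n) := by
      rw [← hper (a + 1 - n)]; congr 1; simp
    have h2 : ∀ j : ℕ, c (a + 1 - (j + 1 : ℕ)) = c (a - j) := fun j => by
      congr 1; push_cast; ring
    simp only [h1, h2] at h
    exact add_right_cancel h
  induction i with
  | zero =>
    have h2 : ∑ j ∈ range n, c (0 - j) = -∑ j ∈ range n, c (0 - j) := by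
      nth_rw 1 [← sum_range_reflect, ← sum_neg_distrib]
      have h3 := hshift (-1)
      rw [neg_add_cancel] at h3
      rw [sum_neg_distrib, h3, ← sum_neg_distrib]
      refine sum_congr rfl fun j hj => ?_
      have hj' := mem_range.1 hj
      rw [← hodd, ← hper]
      congr 1
      omega
    exact_mod_cast self_eq_neg.1 h2
  | succ i ih => push_cast; rw [hshift]; exact ih

/-! ### Bounds and integrability of the phase kernel -/

lemma min_le_pi_div_two_mul_sin {θ : ℝ} (h0 : 0 ≤ θ) (h1 : θ ≤ Real.pi) :
    min θ (Real.pi - θ) ≤ Real.pi / 2 * Real.sin θ := by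
  have key : ∀ {y : ℝ}, 0 ≤ y → y ≤ Real.pi / 2 → y ≤ Real.pi / 2 * Real.sin y := by
    intro y hy hy'
    have h := mul_le_mul_of_nonneg_left (Real.mul_le_sin hy hy') (by positivity : 0 ≤ Real.pi / 2)
    calc y = Real.pi / 2 * (2 / Real.pi * y) := by field_simp
      _ ≤ _ := h
  rcases le_total θ (Real.pi / 2) with h | h
  · exact (min_le_left _ _).trans (key h0 h)
  · rw [← Real.sin_pi_sub]
    exact (min_le_right _ _).trans (key (by linarith) (by linarith))

lemma min_abs_le_pi_mul_abs_sin_half {x : ℝ} (hx : |x| ≤ 2 * Real.pi) :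
    min |x| (2 * Real.pi - |x|) ≤ Real.pi * |Real.sin (x / 2)| := by
  have h := min_le_pi_div_two_mul_sin (θ := |x| / 2) (by positivity) (by linarith)
  have h2 : Real.sin (|x| / 2) ≤ |Real.sin (x / 2)| := by
    rcases abs_cases x with ⟨h, _⟩ | ⟨h, _⟩ <;> rw [h]
    · exact le_abs_self _
    · rw [neg_div, Real.sin_neg]; exact neg_le_abs _
  calc min |x| (2 * Real.pi - |x|) = 2 * min (|x| / 2) (Real.pi - |x| / 2) := by
        rw [mul_min_of_nonneg _ _ two_pos.le]; congr 1 <;> ring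
    _ ≤ 2 * (Real.pi / 2 * Real.sin (|x| / 2)) := by gcongr
    _ = Real.pi * Real.sin (|x| / 2) := by ring
    _ ≤ _ := by gcongr

/-- A Lipschitz function on `[-π, π]` with equal end values is Lipschitz for the distance of the
circle `ℝ / 2πℤ`. -/
lemma norm_sub_le_mul_min_of_periodic {h : ℝ → ℂ} {C : ℝ}
    (hC : ∀ x ∈ Set.Icc (-Real.pi) Real.pi, ∀ y ∈ Set.Icc (-Real.pi) Real.pi,
      ‖h x - h y‖ ≤ C * |x - y|)
    (hper : h Real.pi = h (-Real.pi)) {q k : ℝ} (hq : q ∈ Set.Icc (-Real.pi) Real.pi)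
    (hk : k ∈ Set.Icc (-Real.pi) Real.pi) :
    ‖h q - h k‖ ≤ C * min |q - k| (2 * Real.pi - |q - k|) := by
  wlog hqk : k ≤ q generalizing q k
  · rw [norm_sub_rev, abs_sub_comm]
    exact this hk hq (le_of_not_ge hqk)
  have hπ := Real.pi_pos
  rcases min_choice |q - k| (2 * Real.pi - |q - k|) with hm | hm <;> rw [hm]
  · exact hC q hq k hk
  · have e1 := hC q hq Real.pi ⟨by linarith, le_rfl⟩
    have e2 := hC (-Real.pi) ⟨le_rfl, by linarith⟩ k hk
    rw [abs_of_nonpos (by linarith [hq.2])] at e1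
    rw [abs_of_nonpos (by linarith [hk.1])] at e2
    rw [abs_of_nonneg (by linarith)]
    calc ‖h q - h k‖ = ‖(h q - h Real.pi) + (h (-Real.pi) - h k)‖ := by rw [hper]; congr 1; ring
      _ ≤ _ := norm_add_le _ _
      _ ≤ _ := by linarith

/-- The periodic part of the phase shift, obtained by removing its linear growth. -/
noncomputable def periodicPart (ν : ℝ → ℂ) (δ : ℤ) (q : ℝ) : ℂ :=
  ν q - δ * q / (2 * Real.pi)

lemma phaseKernel_eq (ν : ℝ → ℂ) (δ : ℤ) (q k : ℝ) :
    phaseKernel ν δ q k =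
      ((periodicPart ν δ q - periodicPart ν δ k) / (4 * Real.sin ((q - k) / 2) : ℝ)) ^ 2 := by
  rw [phaseKernel, periodicPart, periodicPart]
  push_cast
  congr 2
  ring

lemma periodicPart_pi {ν : ℝ → ℂ} {δ : ℤ} (hwind : ν Real.pi - ν (-Real.pi) = (δ : ℂ)) :
    periodicPart ν δ Real.pi = periodicPart ν δ (-Real.pi) := by
  have : (Real.pi : ℂ) ≠ 0 := by exact_mod_cast Real.pi_ne_zero
  rw [periodicPart, periodicPart, ← hwind]
  push_cast
  field_simp
  ring

lemma exists_norm_periodicPart_sub_le {ν : ℝ → ℂ}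
    (hν : ContDiffOn ℝ ∞ ν (Set.Icc (-Real.pi) Real.pi)) (δ : ℤ) :
    ∃ C : ℝ, 0 ≤ C ∧ ∀ x ∈ Set.Icc (-Real.pi) Real.pi, ∀ y ∈ Set.Icc (-Real.pi) Real.pi,
      ‖periodicPart ν δ x - periodicPart ν δ y‖ ≤ C * |x - y| := by
  have h : ContDiffOn ℝ ∞ (periodicPart ν δ) (Set.Icc (-Real.pi) Real.pi) := by
    refine hν.sub (ContDiff.contDiffOn ?_)
    exact (contDiff_const.mul Complex.ofRealCLM.contDiff).div_const _
  obtain ⟨K, hK⟩ := h.exists_lipschitzOnWith (by decide) (convex_Icc _ _) isCompact_Icc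
  refine ⟨K, K.2, fun x hx y hy => ?_⟩
  have := hK.dist_le_mul x hx y hy
  rwa [dist_eq_norm, Real.dist_eq] at this

lemma norm_phaseKernel_le {ν : ℝ → ℂ} {δ : ℤ} {C : ℝ} (hC0 : 0 ≤ C)
    (hC : ∀ x ∈ Set.Icc (-Real.pi) Real.pi, ∀ y ∈ Set.Icc (-Real.pi) Real.pi,
      ‖periodicPart ν δ x - periodicPart ν δ y‖ ≤ C * |x - y|)
    (hper : periodicPart ν δ Real.pi = periodicPart ν δ (-Real.pi)) {q k : ℝ}
    (hq : q ∈ Set.Icc (-Real.pi) Real.pi) (hk : k ∈ Set.Icc (-Real.pi) Real.pi) :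
    ‖phaseKernel ν δ q k‖ ≤ (C * Real.pi / 4) ^ 2 := by
  have hπ := Real.pi_pos
  rw [phaseKernel_eq, norm_pow, norm_div, Complex.norm_real, Real.norm_eq_abs, abs_mul,
    abs_of_pos (four_pos : (0 : ℝ) < 4)]
  refine pow_le_pow_left₀ (by positivity) (div_le_of_le_mul₀ (by positivity) (by positivity) ?_) 2
  have hx : |q - k| ≤ 2 * Real.pi := abs_le.2 ⟨by linarith [hq.1, hk.2], by linarith [hq.2, hk.1]⟩
  calc _ ≤ C * min |q - k| (2 * Real.pi - |q - k|) := norm_sub_le_mul_min_of_periodic hC hper hq hk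
    _ ≤ C * (Real.pi * |Real.sin ((q - k) / 2)|) := by
        gcongr; exact min_abs_le_pi_mul_abs_sin_half hx
    _ = _ := by ring

lemma integrableOn_phaseKernel {ν : ℝ → ℂ}
    (hν : ContDiffOn ℝ ∞ ν (Set.Icc (-Real.pi) Real.pi)) {δ : ℤ}
    (hwind : ν Real.pi - ν (-Real.pi) = (δ : ℂ)) :
    IntegrableOn (fun p : ℝ × ℝ => phaseKernel ν δ p.1 p.2)
      (Set.Icc (-Real.pi) Real.pi ×ˢ Set.Icc (-Real.pi) Real.pi) := by
  have hle : -Real.pi ≤ Real.pi := by linarith [Real.pi_pos]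
  obtain ⟨C, hC0, hC⟩ := exists_norm_periodicPart_sub_le hν δ
  have hS : MeasurableSet (Set.Icc (-Real.pi) Real.pi ×ˢ Set.Icc (-Real.pi) Real.pi) :=
    measurableSet_Icc.prod measurableSet_Icc
  -- `ν` need not be measurable off the interval, so it is replaced by a continuous extension
  set ν' : ℝ → ℂ := Set.IccExtend hle ((Set.Icc (-Real.pi) Real.pi).domRestrict ν) with hν'
  have hc : Continuous ν' := hν.continuousOn.domRestrict.Icc_extend'
  have hm : Measurable (fun p : ℝ × ℝ => phaseKernel ν' δ p.1 p.2) := by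
    unfold phaseKernel
    have := hc.measurable
    fun_prop
  have he : Set.EqOn (fun p : ℝ × ℝ => phaseKernel ν' δ p.1 p.2)
      (fun p : ℝ × ℝ => phaseKernel ν δ p.1 p.2)
      (Set.Icc (-Real.pi) Real.pi ×ˢ Set.Icc (-Real.pi) Real.pi) := by
    intro p hp
    have e1 : ν' p.1 = ν p.1 := Set.IccExtend_of_mem hle _ hp.1
    have e2 : ν' p.2 = ν p.2 := Set.IccExtend_of_mem hle _ hp.2
    simp only [phaseKernel, e1, e2]
  refine IntegrableOn.congr_fun (Measure.integrableOn_of_bounded (M := (C * Real.pi / 4) ^ 2)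
    (isCompact_Icc.prod isCompact_Icc).measure_lt_top.ne hm.aestronglyMeasurable ?_) he hS
  filter_upwards [ae_restrict_mem hS] with p hp
  exact (congrArg norm (he hp)).trans_le
    (norm_phaseKernel_le hC0 hC (periodicPart_pi hwind) hp.1 hp.2)

lemma integral_phaseKernel_eq (ν : ℝ → ℂ) (δ : ℤ) :
    ∫ q in (-Real.pi)..Real.pi, ∫ k in (-Real.pi)..Real.pi, phaseKernel ν δ q k =
      4 * Real.pi ^ 2 * ∫ x in (0 : ℝ)..1, ∫ y in (0 : ℝ)..1,
        phaseKernel ν δ (2 * Real.pi * x - Real.pi) (2 * Real.pi * y - Real.pi) := by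
  have h : ∀ f : ℝ → ℂ, ∫ q in (-Real.pi)..Real.pi, f q =
      2 * Real.pi * ∫ x in (0 : ℝ)..1, f (2 * Real.pi * x - Real.pi) := by
    intro f
    have := intervalIntegral.smul_integral_comp_mul_sub (a := 0) (b := 1) f (2 * Real.pi) Real.pi
    rw [show 2 * Real.pi * 0 - Real.pi = -Real.pi by ring,
      show 2 * Real.pi * 1 - Real.pi = Real.pi by ring] at this
    rw [← this, Complex.real_smul]; push_cast; rfl
  rw [h]
  simp_rw [h]
  rw [intervalIntegral.integral_const_mul]
  ring

/-! ### Corrected phases on the lattice -/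

lemma latticeMomentum_succ {L : ℕ} (hL : 0 < L) (i : ℕ) :
    latticeMomentum L ((i : ℤ) + 1) = -Real.pi + 2 * Real.pi * (i + 1 / 2) / L := by
  have : (L : ℝ) ≠ 0 := by exact_mod_cast hL.ne'
  rw [latticeMomentum]
  push_cast
  field_simp
  ring

lemma latticeMomentum_mem_Icc {L i : ℕ} (hi : i < L) :
    latticeMomentum L ((i : ℤ) + 1) ∈ Set.Icc (-Real.pi) Real.pi := by
  have hL : (0 : ℝ) < L := by exact_mod_cast (by omega : 0 < L)
  have hi' : (i : ℝ) + 1 ≤ L := by exact_mod_cast hi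
  have hπ := Real.pi_pos
  rw [latticeMomentum_succ (by omega)]
  constructor
  · have : 0 ≤ 2 * Real.pi * (i + 1 / 2) / L := by positivity
    linarith
  · have : 2 * Real.pi * (i + 1 / 2) / L ≤ 2 * Real.pi := by
      rw [div_le_iff₀ hL]
      have : (i : ℝ) + 1 / 2 ≤ L := by linarith
      gcongr
    linarith

/-- The phase at the `i`-th of `n` sites (counted from zero, on the lattice with `n + m` momenta),
corrected by the linear term `m i / n`. The correction makes it periodic over the `n` occupied
sites up to `O(1 / n)`, and it is exactly what turns the angles `π (i - j) / (n + m)` of the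
numerator into the equidistributed angles `π (i - j) / n`. -/
noncomputable def sitePhase (ν : ℝ → ℂ) (m n i : ℕ) : ℂ :=
  phaseAt ν (n + m) ((i : ℤ) + 1) + m * i / n

/-- The shift of the angle `π (i - j) / n` caused by the phases, divided by the sine of that angle.
It vanishes on the diagonal because division by zero gives zero. -/
noncomputable def relativeShift (ν : ℝ → ℂ) (m n i j : ℕ) : ℂ :=
  Real.pi / (n + m : ℕ) * (sitePhase ν m n i - sitePhase ν m n j) /
    (Real.sin (Real.pi * (i - j) / n) : ℝ)

lemma relativeShift_comm (ν : ℝ → ℂ) (m n i j : ℕ) :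
    relativeShift ν m n i j = relativeShift ν m n j i := by
  rw [relativeShift, relativeShift, ← neg_sub (j : ℝ), mul_neg, neg_div, Real.sin_neg,
    ← neg_sub (sitePhase ν m n j), mul_neg, Complex.ofReal_neg, neg_div_neg_eq]

lemma relativeShift_self (ν : ℝ → ℂ) (m n i : ℕ) : relativeShift ν m n i i = 0 := by
  simp [relativeShift]

/-- Corrected phases differ by at most the circular distance of their sites, up to a factor
of order `1 / n`. -/
lemma norm_sitePhase_sub_le {ν : ℝ → ℂ} {m : ℕ} {C : ℝ} (hC0 : 0 ≤ C)
    (hC : ∀ x ∈ Set.Icc (-Real.pi) Real.pi, ∀ y ∈ Set.Icc (-Real.pi) Real.pi,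
      ‖periodicPart ν (-m) x - periodicPart ν (-m) y‖ ≤ C * |x - y|)
    (hper : periodicPart ν (-m) Real.pi = periodicPart ν (-m) (-Real.pi)) {n i j : ℕ} (hi : i < n)
    (hj : j < i) :
    ‖sitePhase ν m n i - sitePhase ν m n j‖ ≤
      (2 * Real.pi * C * (1 + m) + m ^ 2) / (n + m) * min ((i : ℝ) - j) (n - (i - j)) := by
  have hπ := Real.pi_pos
  have hn : (0 : ℝ) < n := by exact_mod_cast (by omega : 0 < n)
  have hm : (0 : ℝ) ≤ m := Nat.cast_nonneg m
  have hLpos : (0 : ℝ) < n + m := by linarith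
  have hqi := latticeMomentum_mem_Icc (L := n + m) (i := i) (by omega)
  have hqj := latticeMomentum_mem_Icc (L := n + m) (i := j) (by omega)
  set d : ℝ := (i : ℝ) - j with hd
  have hd1 : 1 ≤ d := by
    have : (j : ℝ) + 1 ≤ i := by exact_mod_cast hj
    linarith
  have hd2 : 1 ≤ n - d := by
    have h1 : (i : ℝ) + 1 ≤ n := by exact_mod_cast hi
    have h2 : (0 : ℝ) ≤ j := Nat.cast_nonneg j
    linarith
  have hdiff : latticeMomentum (n + m) ((i : ℤ) + 1) - latticeMomentum (n + m) ((j : ℤ) + 1) =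
      2 * Real.pi / (n + m) * d := by
    rw [latticeMomentum_succ (by omega), latticeMomentum_succ (by omega), hd]
    push_cast
    field_simp
    ring
  have hsplit : sitePhase ν m n i - sitePhase ν m n j =
      (periodicPart ν (-m) (latticeMomentum (n + m) ((i : ℤ) + 1)) -
        periodicPart ν (-m) (latticeMomentum (n + m) ((j : ℤ) + 1))) +
        ((m ^ 2 * d / (n * (n + m)) : ℝ) : ℂ) := by
    have hdiff' : (latticeMomentum (n + m) ((i : ℤ) + 1) : ℂ) =
        latticeMomentum (n + m) ((j : ℤ) + 1) + 2 * Real.pi / (n + m) * d := by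
      have := congrArg (fun x : ℝ => (x : ℂ)) hdiff
      push_cast at this
      linear_combination this
    have h1 : (Real.pi : ℂ) ≠ 0 := by exact_mod_cast hπ.ne'
    have h2 : (n : ℂ) ≠ 0 := by exact_mod_cast hn.ne'
    have h3 : (n : ℂ) + m ≠ 0 := by exact_mod_cast hLpos.ne'
    rw [sitePhase, sitePhase, periodicPart, periodicPart, phaseAt, phaseAt, hdiff', hd]
    push_cast
    field_simp
    ring
  have h1 := norm_sub_le_mul_min_of_periodic hC hper hqi hqj
  rw [hdiff, abs_of_nonneg (by positivity)] at h1
  have hmin : min (2 * Real.pi / (n + m) * d) (2 * Real.pi - 2 * Real.pi / (n + m) * d) ≤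
      2 * Real.pi / (n + m) * ((1 + m) * min d (n - d)) := by
    have : 2 * Real.pi - 2 * Real.pi / (n + m) * d = 2 * Real.pi / (n + m) * (n + m - d) := by
      field_simp
    rw [this, ← mul_min_of_nonneg _ _ (by positivity)]
    gcongr
    rw [mul_min_of_nonneg _ _ (by positivity)]
    exact min_le_min (by nlinarith) (by nlinarith)
  have h2 : m ^ 2 * d / (n * (n + m)) ≤ (m : ℝ) ^ 2 / (n + m) * min d (n - d) := by
    calc (m : ℝ) ^ 2 * d / (n * (n + m)) = m ^ 2 / (n + m) * (d / n) := by field_simp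
      _ ≤ _ := by
        gcongr
        exact ((div_le_one hn).2 (by linarith)).trans (le_min hd1 hd2)
  rw [hsplit]
  calc _ ≤ C * (2 * Real.pi / (n + m) * ((1 + m) * min d (n - d))) +
        (m : ℝ) ^ 2 / (n + m) * min d (n - d) := by
        refine (norm_add_le _ _).trans (add_le_add (h1.trans ?_) ?_)
        · gcongr
        · rw [Complex.norm_real, Real.norm_of_nonneg (by positivity)]; exact h2
    _ = _ := by field_simp

lemma exists_norm_relativeShift_le {ν : ℝ → ℂ}
    (hν : ContDiffOn ℝ ∞ ν (Set.Icc (-Real.pi) Real.pi)) {m : ℕ}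
    (hwind : ν Real.pi - ν (-Real.pi) = ((-m : ℤ) : ℂ)) :
    ∃ B : ℝ, 0 ≤ B ∧ ∀ n i j : ℕ, i < n → j < n → ‖relativeShift ν m n i j‖ ≤ B / n := by
  obtain ⟨C, hC0, hC⟩ := exists_norm_periodicPart_sub_le hν (-m)
  have hπ := Real.pi_pos
  set D : ℝ := 2 * Real.pi * C * (1 + m) + m ^ 2 with hD
  have hD0 : 0 ≤ D := by positivity
  refine ⟨Real.pi / 2 * D, by positivity, fun n i j hi hj => ?_⟩
  wlog hji : j ≤ i generalizing i j
  · rw [relativeShift_comm]; exact this j i hj hi (le_of_not_ge hji)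
  rcases hji.eq_or_lt with rfl | hji
  · rw [relativeShift_self, norm_zero]; positivity
  have hn : (0 : ℝ) < n := by exact_mod_cast (by omega : 0 < n)
  have hm : (0 : ℝ) ≤ m := Nat.cast_nonneg m
  have h1 := norm_sitePhase_sub_le hC0 hC (periodicPart_pi hwind) hi hji
  rw [← hD] at h1
  have hi' : (i : ℝ) < n := by exact_mod_cast hi
  have hji' : (j : ℝ) < i := by exact_mod_cast hji
  have hj0 : (0 : ℝ) ≤ j := Nat.cast_nonneg j
  have hle : Real.pi * ((i : ℝ) - j) / n ≤ Real.pi := by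
    rw [div_le_iff₀ hn]; gcongr; linarith
  have h0 : 0 ≤ Real.pi * ((i : ℝ) - j) / n :=
    div_nonneg (mul_nonneg hπ.le (by linarith)) hn.le
  have h2 := min_le_pi_div_two_mul_sin h0 hle
  have h3 : min (Real.pi * ((i : ℝ) - j) / n) (Real.pi - Real.pi * (i - j) / n) =
      Real.pi / n * min ((i : ℝ) - j) (n - (i - j)) := by
    rw [mul_min_of_nonneg _ _ (by positivity)]
    congr 1 <;> field_simp
  rw [h3] at h2
  set s := Real.sin (Real.pi * ((i : ℝ) - j) / n) with hs
  have hs0 : 0 ≤ s := Real.sin_nonneg_of_nonneg_of_le_pi h0 hle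
  have h4 : min ((i : ℝ) - j) (n - (i - j)) ≤ n / 2 * s := by
    have := mul_le_mul_of_nonneg_left h2 (by positivity : 0 ≤ n / Real.pi)
    calc _ = n / Real.pi * (Real.pi / n * min ((i : ℝ) - j) (n - (i - j))) := by field_simp
      _ ≤ _ := this
      _ = _ := by field_simp
  rw [relativeShift, norm_div, norm_mul, norm_div, Complex.norm_real, Complex.norm_natCast,
    Complex.norm_real, Real.norm_of_nonneg hπ.le, Real.norm_of_nonneg hs0]
  refine div_le_of_le_mul₀ hs0 (by positivity) ?_
  push_cast
  calc Real.pi / (n + m) * ‖sitePhase ν m n i - sitePhase ν m n j‖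
      ≤ Real.pi / n * (D / n * (n / 2 * s)) := by
        gcongr
        · linarith
        · refine h1.trans ?_
          gcongr
          · exact le_min (by linarith) (by linarith)
          · linarith
    _ = _ := by field_simp

/-- The contributions of first order cancel: the cotangent is odd and periodic, hence sums to zero
over the equidistributed angles. -/
lemma sum_relativeShift_mul_cos (ν : ℝ → ℂ) (m n : ℕ) :
    ∑ i ∈ range n, ∑ j ∈ range i,
      relativeShift ν m n i j * (Real.cos (Real.pi * (i - j) / n) : ℝ) = 0 := by
  rcases Nat.eq_zero_or_pos n with rfl | hn
  · simp
  have hn' : (n : ℝ) ≠ 0 := by exact_mod_cast hn.ne'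
  set c : ℤ → ℂ := fun d =>
    ((Real.cos (Real.pi * d / n) / Real.sin (Real.pi * d / n) : ℝ) : ℂ) with hc
  have hodd : ∀ d, c (-d) = -c d := by
    intro d
    simp only [hc]
    push_cast
    rw [mul_neg, neg_div, Complex.cos_neg, Complex.sin_neg, div_neg]
  have hper : ∀ d : ℤ, c (d + n) = c d := by
    intro d
    simp only [hc]
    have : Real.pi * ((d + n : ℤ) : ℝ) / n = Real.pi * d / n + Real.pi := by
      push_cast; field_simp
    rw [this, Real.cos_add_pi, Real.sin_add_pi, neg_div_neg_eq]
  have hterm : ∀ i j : ℕ, relativeShift ν m n i j * (Real.cos (Real.pi * (i - j) / n) : ℝ) =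
      Real.pi / (n + m : ℕ) * (sitePhase ν m n i * c ((i : ℤ) - j)) +
        Real.pi / (n + m : ℕ) * (sitePhase ν m n j * c ((j : ℤ) - i)) := by
    intro i j
    rw [← neg_sub (i : ℤ) j, hodd, relativeShift]
    simp only [hc]
    push_cast
    ring
  have hsum : ∑ i ∈ range n, ∑ j ∈ range n,
      Real.pi / (n + m : ℕ) * (sitePhase ν m n i * c ((i : ℤ) - j)) = 0 := by
    refine sum_eq_zero fun i _ => ?_
    rw [← mul_sum, ← mul_sum, sum_range_sub_eq_zero_of_odd_periodic hodd hper, mul_zero, mul_zero]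
  have h := sum_range_sum_range_eq_of_symm (n := n) (f := fun i j =>
    relativeShift ν m n i j * (Real.cos (Real.pi * (i - j) / n) : ℝ)) (fun i j => by
      rw [relativeShift_comm, ← neg_sub (j : ℝ), mul_neg, neg_div, Real.cos_neg])
    (fun i => by rw [relativeShift_self, zero_mul])
  have h2 : ∑ i ∈ range n, ∑ j ∈ range n,
      relativeShift ν m n i j * (Real.cos (Real.pi * (i - j) / n) : ℝ) = 0 := by
    simp only [hterm, sum_add_distrib]
    rw [hsum, zero_add, sum_comm, hsum]
  rw [h2] at h
  exact (mul_eq_zero.1 h).resolve_left two_ne_zero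

/-! ### Limit of the perturbed product -/

lemma tendsto_floor_mul_div {x : ℝ} (hx : 0 ≤ x) :
    Tendsto (fun n : ℕ => (⌊n * x⌋₊ : ℝ) / n) atTop (𝓝 x) := by
  refine ((tendsto_nat_floor_mul_div_atTop hx).comp tendsto_natCast_atTop_atTop).congr fun n => ?_
  simp [mul_comm]

lemma tendsto_sitePhase_floor {ν : ℝ → ℂ}
    (hν : ContinuousOn ν (Set.Icc (-Real.pi) Real.pi)) (m : ℕ) {x : ℝ}
    (hx : x ∈ Set.Ioo (0 : ℝ) 1) :
    Tendsto (fun n : ℕ => sitePhase ν m n ⌊n * x⌋₊) atTop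
      (𝓝 (ν (2 * Real.pi * x - Real.pi) + m * x)) := by
  have hπ := Real.pi_pos
  have hfl := tendsto_floor_mul_div hx.1.le
  have hmem : 2 * Real.pi * x - Real.pi ∈ Set.Icc (-Real.pi) Real.pi :=
    ⟨by nlinarith [hx.1], by nlinarith [hx.2]⟩
  have hq : Tendsto (fun n : ℕ => latticeMomentum (n + m) ((⌊n * x⌋₊ : ℕ) + 1 : ℤ)) atTop
      (𝓝 (2 * Real.pi * x - Real.pi)) := by
    have h1 : Tendsto (fun n : ℕ => -Real.pi + 2 * Real.pi *
        (((⌊n * x⌋₊ : ℝ) / n + 1 / 2 / n) * ((n : ℝ) / (n + m)))) atTop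
        (𝓝 (-Real.pi + 2 * Real.pi * ((x + 0) * 1))) :=
      (((hfl.add (tendsto_const_div_atTop_nhds_zero_nat _)).mul
        (tendsto_natCast_div_add_atTop (m : ℝ))).const_mul _).const_add _
    rw [show -Real.pi + 2 * Real.pi * ((x + 0) * 1) = 2 * Real.pi * x - Real.pi by ring] at h1
    refine h1.congr' ?_
    filter_upwards [eventually_gt_atTop 0] with n hn
    have hn' : (0 : ℝ) < n := by exact_mod_cast hn
    have : (0 : ℝ) < n + m := by positivity
    rw [latticeMomentum_succ (by omega)]
    push_cast
    field_simp
  refine Tendsto.add ?_ ?_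
  · refine (hν _ hmem).tendsto.comp (tendsto_nhdsWithin_iff.2 ⟨hq, ?_⟩)
    filter_upwards [eventually_gt_atTop 0] with n hn
    have hn' : (0 : ℝ) < n := by exact_mod_cast hn
    have : ⌊n * x⌋₊ < n := by
      rw [Nat.floor_lt (by have := hx.1; positivity)]
      nlinarith [hx.2]
    exact latticeMomentum_mem_Icc (by omega)
  · have := ((Complex.continuous_ofReal.tendsto x).comp hfl).const_mul (m : ℂ)
    refine this.congr fun n => ?_
    simp [mul_div_assoc]

lemma tendsto_sq_mul_relativeShift_floor {ν : ℝ → ℂ}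
    (hν : ContinuousOn ν (Set.Icc (-Real.pi) Real.pi)) (m : ℕ) {x y : ℝ}
    (hx : x ∈ Set.Ioo (0 : ℝ) 1) (hy : y ∈ Set.Ioo (0 : ℝ) 1) (hxy : x ≠ y) :
    Tendsto (fun n : ℕ => ((n : ℂ) * relativeShift ν m n ⌊n * x⌋₊ ⌊n * y⌋₊) ^ 2) atTop
      (𝓝 (16 * Real.pi ^ 2 *
        phaseKernel ν (-m) (2 * Real.pi * x - Real.pi) (2 * Real.pi * y - Real.pi))) := by
  have hπ := Real.pi_pos
  have hsin : Real.sin (Real.pi * (x - y)) ≠ 0 := by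
    rw [Ne, Real.sin_eq_zero_iff_of_lt_of_lt]
    · exact mul_ne_zero hπ.ne' (sub_ne_zero.2 hxy)
    · nlinarith [hx.1, hy.2]
    · nlinarith [hx.2, hy.1]
  have hden : Tendsto (fun n : ℕ => ((Real.sin (Real.pi *
      ((⌊n * x⌋₊ : ℝ) - (⌊n * y⌋₊ : ℝ)) / n) : ℝ) : ℂ)) atTop
      (𝓝 ((Real.sin (Real.pi * (x - y)) : ℝ) : ℂ)) := by
    have h := ((tendsto_floor_mul_div hx.1.le).sub (tendsto_floor_mul_div hy.1.le)).const_mul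
      Real.pi
    refine (((Complex.continuous_ofReal.comp Real.continuous_sin).tendsto _).comp h).congr
      fun n => ?_
    simp only [Function.comp_apply, ← sub_div, mul_div_assoc]
  have hnum := (tendsto_sitePhase_floor hν m hx).sub (tendsto_sitePhase_floor hν m hy)
  have hfac : Tendsto (fun n : ℕ => (n : ℂ) / (n + m)) atTop (𝓝 1) :=
    tendsto_natCast_div_add_atTop (m : ℂ)
  have h := (((hfac.mul_const (Real.pi : ℂ)).mul hnum).div hden (by exact_mod_cast hsin)).pow 2
  refine (h.congr fun n => ?_).trans (le_of_eq ?_)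
  · rw [relativeShift, Pi.div_apply]; push_cast; ring
  · congr 1
    have h1 : (2 * Real.pi * x - Real.pi - (2 * Real.pi * y - Real.pi)) / 2 =
        Real.pi * (x - y) := by ring
    have h2 : (Real.pi : ℂ) ≠ 0 := by exact_mod_cast hπ.ne'
    have h3 : ((Real.sin (Real.pi * (x - y)) : ℝ) : ℂ) ≠ 0 := by exact_mod_cast hsin
    rw [phaseKernel_eq, h1, periodicPart, periodicPart, Complex.ofReal_mul]
    push_cast at h3 ⊢
    field_simp
    ring

/-- The contributions of second order form a Riemann sum of the phase kernel. -/
lemma tendsto_sum_relativeShift_sq {ν : ℝ → ℂ}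
    (hν : ContDiffOn ℝ ∞ ν (Set.Icc (-Real.pi) Real.pi)) {m : ℕ}
    (hwind : ν Real.pi - ν (-Real.pi) = ((-m : ℤ) : ℂ)) :
    Tendsto (fun n : ℕ => ∑ i ∈ range n, ∑ j ∈ range i, relativeShift ν m n i j ^ 2 / 2) atTop
      (𝓝 (∫ q in (-Real.pi)..Real.pi, ∫ k in (-Real.pi)..Real.pi, phaseKernel ν (-m) q k)) := by
  obtain ⟨B, hB0, hB⟩ := exists_norm_relativeShift_le hν hwind
  have h := tendsto_double_sum_div_sq (F := fun n i j => ((n : ℂ) * relativeShift ν m n i j) ^ 2)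
    (B := B ^ 2) (by
      filter_upwards [eventually_gt_atTop 0] with n hn i hi j hj
      have hn' : (0 : ℝ) < n := by exact_mod_cast hn
      rw [norm_pow, norm_mul, Complex.norm_natCast]
      refine pow_le_pow_left₀ (by positivity) ?_ 2
      calc _ ≤ n * (B / n) := by gcongr; exact hB n i j hi hj
        _ = B := by field_simp)
    (fun x hx y hy hxy => tendsto_sq_mul_relativeShift_floor hν.continuousOn m hx hy hxy)
  have h2 := h.div_const 4
  simp only [intervalIntegral.integral_const_mul] at h2
  rw [integral_phaseKernel_eq]
  convert h2.congr' ?_ using 2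
  · ring
  filter_upwards [eventually_gt_atTop 0] with n hn
  have hn' : (n : ℂ) ≠ 0 := by exact_mod_cast hn.ne'
  have hs := sum_range_sum_range_eq_of_symm (n := n) (f := fun i j => relativeShift ν m n i j ^ 2 / 2)
    (fun i j => by rw [relativeShift_comm]) (fun i => by rw [relativeShift_self]; simp)
  rw [← mul_right_inj' (two_ne_zero (α := ℂ)), hs, sum_div, sum_div, mul_sum]
  refine sum_congr rfl fun i _ => ?_
  rw [sum_div, sum_div, mul_sum]
  refine sum_congr rfl fun j _ => ?_
  field_simp
  ring

/-- The product of the perturbed sines over the equidistributed angles, relative to the unperturbed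
one, converges to the exponential of minus the double integral. -/
lemma tendsto_prod_sin_sub_div_sin {ν : ℝ → ℂ}
    (hν : ContDiffOn ℝ ∞ ν (Set.Icc (-Real.pi) Real.pi)) {m : ℕ}
    (hwind : ν Real.pi - ν (-Real.pi) = ((-m : ℤ) : ℂ)) :
    Tendsto (fun n : ℕ => ∏ i ∈ range n, ∏ j ∈ range i,
      Complex.sin ((Real.pi * (i - j) / n : ℝ) -
        Real.pi / (n + m : ℕ) * (sitePhase ν m n i - sitePhase ν m n j)) /
        (Real.sin (Real.pi * (i - j) / n) : ℝ)) atTop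
      (𝓝 (Complex.exp (-∫ q in (-Real.pi)..Real.pi, ∫ k in (-Real.pi)..Real.pi,
        phaseKernel ν (-m) q k))) := by
  obtain ⟨B, hB0, hB⟩ := exists_norm_relativeShift_le hν hwind
  -- the remainder of each factor, after its terms of first and second order
  have hfac : ∀ n i j : ℕ, ∃ R : ℂ, 4 * B ≤ n → j < i → i < n → ‖R‖ ≤ 8 * (B / n) ^ 3 ∧
      Complex.sin ((Real.pi * (i - j) / n : ℝ) -
        Real.pi / (n + m : ℕ) * (sitePhase ν m n i - sitePhase ν m n j)) /
        (Real.sin (Real.pi * (i - j) / n) : ℝ) =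
      Complex.exp (-(relativeShift ν m n i j * (Real.cos (Real.pi * (i - j) / n) : ℝ)) -
        relativeShift ν m n i j ^ 2 / 2 + R) := by
    intro n i j
    by_cases h : 4 * B ≤ n ∧ j < i ∧ i < n
    · obtain ⟨hnB, hji, hin⟩ := h
      have hn : (0 : ℝ) < n := by exact_mod_cast (by omega : 0 < n)
      have hji' : (j : ℝ) < i := by exact_mod_cast hji
      have hin' : (i : ℝ) < n := by exact_mod_cast hin
      have hj0 : (0 : ℝ) ≤ j := Nat.cast_nonneg j
      have hsin : Real.sin (Real.pi * (i - j) / n) ≠ 0 := by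
        refine (Real.sin_pos_of_pos_of_lt_pi ?_ ?_).ne'
        · exact div_pos (mul_pos Real.pi_pos (by linarith)) hn
        · rw [div_lt_iff₀ hn]
          exact mul_lt_mul_of_pos_left (by linarith) Real.pi_pos
      obtain ⟨R, hR, hRe⟩ := exists_sin_sub_eq_mul_exp hsin (hB n i j hin (hji.trans hin))
        (by rw [div_le_iff₀ hn]; linarith)
      have hsin' : ((Real.sin (Real.pi * (i - j) / n) : ℝ) : ℂ) ≠ 0 := by exact_mod_cast hsin
      refine ⟨R, fun _ _ _ => ⟨hR, ?_⟩⟩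
      rw [div_eq_iff hsin', mul_comm (Complex.exp _), ← hRe]
      congr 2
      rw [relativeShift, div_mul_cancel₀ _ hsin']
    · exact ⟨0, fun h1 h2 h3 => absurd ⟨h1, h2, h3⟩ h⟩
  choose R hR using hfac
  have hRlim : Tendsto (fun n : ℕ => ∑ i ∈ range n, ∑ j ∈ range i, R n i j) atTop (𝓝 0) := by
    refine squeeze_zero_norm' ?_ (tendsto_const_div_atTop_nhds_zero_nat (8 * B ^ 3))
    filter_upwards [eventually_gt_atTop 0, eventually_ge_atTop ⌈4 * B⌉₊] with n hn hnB
    have hn' : (0 : ℝ) < n := by exact_mod_cast hn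
    calc _ ≤ ∑ i ∈ range n, (n : ℝ) * (8 * (B / n) ^ 3) := by
          refine norm_sum_le_of_le _ fun i hi => ?_
          have hi := mem_range.1 hi
          refine (norm_sum_le_of_le _ fun j hj =>
            (hR n i j (Nat.ceil_le.1 hnB) (mem_range.1 hj) hi).1).trans ?_
          rw [sum_const, card_range, nsmul_eq_mul]
          gcongr
      _ = 8 * B ^ 3 / n := by
          rw [sum_const, card_range, nsmul_eq_mul]; field_simp
  have h := ((tendsto_sum_relativeShift_sq hν hwind).neg.add hRlim).cexp
  rw [add_zero] at h
  refine h.congr' ?_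
  filter_upwards [eventually_ge_atTop ⌈4 * B⌉₊] with n hnB
  symm
  calc _ = ∏ i ∈ range n, ∏ j ∈ range i, Complex.exp
        (-(relativeShift ν m n i j * (Real.cos (Real.pi * (i - j) / n) : ℝ)) -
        relativeShift ν m n i j ^ 2 / 2 + R n i j) :=
        prod_congr rfl fun i hi => prod_congr rfl fun j hj =>
          (hR n i j (Nat.ceil_le.1 hnB) (mem_range.1 hj) (mem_range.1 hi)).2
    _ = _ := by
        simp only [← Complex.exp_sum, sum_add_distrib, sum_sub_distrib, sum_neg_distrib,
          sum_relativeShift_mul_cos, neg_zero, zero_sub]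

/-! ### Asymptotics of the double product -/

lemma prod_Icc_one_natCast (f : ℤ → ℂ) (n : ℕ) :
    ∏ i ∈ Icc (1 : ℤ) n, f i = ∏ i ∈ range n, f (i + 1) := by
  refine Eq.trans ?_
    (prod_map (range n) ⟨fun i : ℕ => (i : ℤ) + 1, fun a b h => by simpa using h⟩ f)
  congr 1
  ext a
  simp only [mem_Icc, Finset.mem_map, mem_range]
  refine ⟨fun h => ⟨(a - 1).toNat, by omega, ?_⟩, fun ⟨k, hk, h⟩ => ?_⟩
  · change (((a - 1).toNat : ℕ) : ℤ) + 1 = a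
    omega
  · change (k : ℤ) + 1 = a at h
    omega

/-- The exact factorization of the double product: the angles `π (i - j - ν_i + ν_j) / (n + m)` are
perturbations of `π (i - j) / n`, and the product of the unperturbed sines is explicit. -/
lemma sineDoubleProduct_eq (ν : ℝ → ℂ) (m n : ℕ) :
    sineDoubleProduct ν (n + m) n =
      ((∏ i ∈ range n, sinePartialProduct n i / sinePartialProduct (n + m) i : ℝ) : ℂ) *
      ∏ i ∈ range n, ∏ j ∈ range i,
        Complex.sin ((Real.pi * (i - j) / n : ℝ) -
          Real.pi / (n + m : ℕ) * (sitePhase ν m n i - sitePhase ν m n j)) /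
          (Real.sin (Real.pi * (i - j) / n) : ℝ) := by
  rw [sineDoubleProduct, prod_Icc_one_natCast, Complex.ofReal_prod, ← prod_mul_distrib]
  refine prod_congr rfl fun i hi => ?_
  have hi := mem_range.1 hi
  have hn : (0 : ℝ) < n := by exact_mod_cast (by omega : 0 < n)
  rw [add_sub_cancel_right, prod_Icc_one_natCast, sinePartialProduct, sinePartialProduct,
    ← prod_div_distrib, ← prod_range_reflect (fun d : ℕ => 2 * Real.sin (Real.pi * (d + 1) / n) /
      (2 * Real.sin (Real.pi * (d + 1) / (n + m : ℕ)))), Complex.ofReal_prod, ← prod_mul_distrib]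
  refine prod_congr rfl fun j hj => ?_
  have hji := mem_range.1 hj
  have hd : (((i - 1 - j : ℕ) : ℝ) + 1) = i - j := by
    rw [Nat.sub_sub, add_comm 1 j, Nat.cast_sub hji]; push_cast; ring
  have hji' : (j : ℝ) < i := by exact_mod_cast hji
  have hin' : (i : ℝ) < n := by exact_mod_cast hi
  have hj0 : (0 : ℝ) ≤ j := Nat.cast_nonneg j
  have hsin : ((Real.sin (Real.pi * (i - j) / n) : ℝ) : ℂ) ≠ 0 := by
    have : 0 < Real.sin (Real.pi * (i - j) / n) := by
      refine Real.sin_pos_of_pos_of_lt_pi ?_ ?_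
      · exact div_pos (mul_pos Real.pi_pos (by linarith)) hn
      · rw [div_lt_iff₀ hn]
        exact mul_lt_mul_of_pos_left (by linarith) Real.pi_pos
    exact_mod_cast this.ne'
  have hn2 : (n : ℂ) ≠ 0 := by exact_mod_cast hn.ne'
  have hL2 : (n : ℂ) + m ≠ 0 := by exact_mod_cast (by omega : n + m ≠ 0)
  have harg : (Real.pi : ℂ) / (n + m : ℕ) * ((((i : ℤ) + 1 : ℤ) : ℂ) - ((j : ℤ) + 1 : ℤ) -
      phaseAt ν (n + m) ((i : ℤ) + 1) + phaseAt ν (n + m) ((j : ℤ) + 1)) =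
      (Real.pi * (i - j) / n : ℝ) -
          Real.pi / (n + m : ℕ) * (sitePhase ν m n i - sitePhase ν m n j) := by
    rw [sitePhase, sitePhase]
    push_cast
    field_simp
    ring
  have hden : (Real.pi : ℂ) * ((((i : ℤ) + 1 : ℤ) : ℂ) - ((j : ℤ) + 1 : ℤ)) / (n + m : ℕ) =
      (Real.pi * (i - j) / (n + m : ℕ) : ℝ) := by
    push_cast; ring
  rw [harg, hden, hd, ← Complex.ofReal_sin (Real.pi * (i - j) / (n + m : ℕ))]
  rw [mul_div_mul_left _ _ two_ne_zero, Complex.ofReal_div _ (Real.sin _)]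
  field_simp

theorem lemma5 (ν : ℝ → ℂ) (hν : ContDiffOn ℝ ∞ ν (Set.Icc (-Real.pi) Real.pi))
    (δ : ℤ) (hδ : δ < 0) (hwind : ν Real.pi - ν (-Real.pi) = (δ : ℂ)) :
    MeasureTheory.IntegrableOn (fun p : ℝ × ℝ => phaseKernel ν δ p.1 p.2)
        (Set.Icc (-Real.pi) Real.pi ×ˢ Set.Icc (-Real.pi) Real.pi) ∧
      Asymptotics.IsEquivalent Filter.atTop
        (fun L : ℕ => sineDoubleProduct ν L ((L : ℤ) + δ))
        (fun L : ℕ =>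
          (((L : ℝ) ^ ((δ : ℝ) ^ 2 / 2) *
              (2 * Real.pi) ^ (-((δ : ℝ) ^ 2 + (δ : ℝ)) / 2) *
              Real.exp ((δ : ℝ) / 2) / barnesG (1 - δ).toNat : ℝ) : ℂ) *
            Complex.exp (-∫ q in (-Real.pi)..Real.pi, ∫ k in (-Real.pi)..Real.pi,
              phaseKernel ν δ q k)) := by
  refine ⟨integrableOn_phaseKernel hν hwind, ?_⟩
  obtain ⟨m, rfl⟩ : ∃ m : ℕ, δ = -m := ⟨(-δ).toNat, by omega⟩
  have hG : (1 - (-m : ℤ)).toNat = m + 1 := by omega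
  rw [hG]
  set E := Complex.exp (-∫ q in (-Real.pi)..Real.pi, ∫ k in (-Real.pi)..Real.pi,
    phaseKernel ν (-m) q k) with hE
  set c : ℝ := Real.exp (-m / 2) * (2 * Real.pi) ^ (-((m : ℝ) ^ 2 - m) / 2) / barnesG (m + 1) with hc
  have hG0 : 0 < barnesG (m + 1) := by
    rw [barnesG_succ_eq_prod_factorial]; positivity
  have hc0 : (c : ℂ) ≠ 0 := by
    have : 0 < c := by positivity
    exact_mod_cast this.ne'
  have hE0 : E ≠ 0 := Complex.exp_ne_zero _
  refine Asymptotics.isEquivalent_of_tendsto_one ?_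
  rw [← tendsto_add_atTop_iff_nat m]
  have h := (((Complex.continuous_ofReal.tendsto c).comp
    (tendsto_prod_sinePartialProduct_div m)).mul (tendsto_prod_sin_sub_div_sin hν hwind)).div_const
      ((c : ℂ) * E)
  rw [← hE, div_self (mul_ne_zero hc0 hE0)] at h
  refine h.congr' ?_
  filter_upwards [eventually_gt_atTop 0] with n hn
  have hL : ((((n + m : ℕ) : ℝ) ^ ((m : ℝ) ^ 2 / 2) : ℝ) : ℂ) ≠ 0 := by
    have h1 : (0 : ℝ) < ((n + m : ℕ) : ℝ) := by exact_mod_cast (by omega : 0 < n + m)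
    exact_mod_cast (Real.rpow_pos_of_pos h1 _).ne'
  have hcast : ((n + m : ℕ) : ℤ) + (-m : ℤ) = n := by push_cast; ring
  have hconst : (((n + m : ℕ) : ℝ) ^ ((((-m : ℤ) : ℝ)) ^ 2 / 2) *
      (2 * Real.pi) ^ (-((((-m : ℤ) : ℝ)) ^ 2 + ((-m : ℤ) : ℝ)) / 2) *
        Real.exp (((-m : ℤ) : ℝ) / 2) / barnesG (m + 1) : ℝ) =
      ((n + m : ℕ) : ℝ) ^ ((m : ℝ) ^ 2 / 2) * c := by
    rw [hc]
    push_cast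
    rw [neg_sq, ← sub_eq_add_neg]
    ring
  simp only [Pi.div_apply, Function.comp_apply]
  rw [hcast, hconst, sineDoubleProduct_eq, Complex.ofReal_div, Complex.ofReal_mul]
  field_simp
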